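/- Let $\mathbb Z$ be the discrete group of integers and let $G=\operatorname{Hom}(\mathbb Z^{\mathbb N},\mathbb Z)$ be the group, under pointwise addition, of all group homomorphisms from $\mathbb Z^{\mathbb N}$ to $\mathbb Z$, endowed with the topology of pointwise convergence (that is, the subspace topology from the Tychonoff product $\mathbb Z^{\mathbb Z^{\mathbb N}}$). For an abelian topological group $A$, let $A^\wedge$ denote its Pontryagin dual: the group of all continuous homomorphisms from $A$ to the circle group $\mathbb T$, with pointwise operation and the compact-open topology. Then the second dual $G^{\wedge\wedge}$ of $G$ is discrete and algebraically isomorphic to $G$; more precisely, the evaluation map $\alpha_G:G\to G^{\wedge\wedge}$, $\alpha_G(g)(\chi)=\chi(g)$, is an isomorphism of abstract groups. -/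

import Mathlib

/-- The Baer-Specker group `ℤ^ℕ`. -/
abbrev BaerSpecker : Type := ℕ → ℤ

/-- The group `G = Hom(ℤ^ℕ, ℤ)` of all (abstract) group homomorphisms from the Baer-Specker group
to `ℤ`. It carries pointwise addition and the topology of pointwise convergence, see below. -/
def BaerSpeckerHom : Type := BaerSpecker →+ ℤ

namespace BaerSpeckerHom

noncomputable instance : AddCommGroup BaerSpeckerHom :=
  inferInstanceAs (AddCommGroup (BaerSpecker →+ ℤ))

instance : FunLike BaerSpeckerHom BaerSpecker ℤ :=
  inferInstanceAs (FunLike (BaerSpecker →+ ℤ) BaerSpecker ℤ)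

/-- The topology of pointwise convergence: the one induced from the Tychonoff product
`∏_{x ∈ ℤ^ℕ} ℤ` of copies of the discrete group `ℤ`. -/
instance : TopologicalSpace BaerSpeckerHom :=
  TopologicalSpace.induced (fun (g : BaerSpeckerHom) (x : BaerSpecker) => g x)
    Pi.topologicalSpace

end BaerSpeckerHom

/-! By Specker's theorem `G` is free on the coordinate projections, and Baire category makes its
compact subsets finite. Hence `G^∧` has the topology induced from `𝕋^ℕ` through `dualCoord`. Since
`𝕋` has no small subgroups, a character of `G^∧` depends on finitely many coordinates, and on each
it is an integral power; so it is evaluation at an element of `G`. For discreteness, the characters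
nontrivial on at most one coordinate form a compact union of circles, and an element of the bidual
sending them all into a small arc is trivial. -/

/-! ### Specker's theorem on homomorphisms `ℤ^ℕ → ℤ`. -/

open Finset in
/-- Splitting off the first `n` coordinates of a vector in the value of a homomorphism. -/
theorem BaerSpecker.map_eq_sum_add_map_tail (g : BaerSpecker →+ ℤ) (x : BaerSpecker) (n : ℕ) :
    g x = ∑ i ∈ range n, x i * g (Pi.single i 1) + g (fun i => if i < n then 0 else x i) := by
  have h : x = ∑ i ∈ range n, x i • (Pi.single i 1 : BaerSpecker) +
      fun i => if i < n then 0 else x i := by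
    ext j
    simp only [Pi.add_apply, Finset.sum_apply, Pi.smul_apply, Pi.single_apply, smul_eq_mul,
      mul_ite, mul_one, mul_zero, Finset.sum_ite_eq, mem_range]
    split_ifs <;> simp
  conv_lhs => rw [h]
  simp only [map_add, map_sum, map_zsmul, smul_eq_mul]

theorem BaerSpecker.dvd_map (g : BaerSpecker →+ ℤ) {x : BaerSpecker} {d : ℤ}
    (h : ∀ i, d ∣ x i) : d ∣ g x := by
  choose y hy using h
  have : x = d • y := by ext i; simp [hy i]
  rw [this, map_zsmul]
  simp

/-- Dropping the first `n` coordinates does not change `g x` and leaves a multiple of `p ^ n`, so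
every `p ^ n` divides `g x`. -/
theorem BaerSpecker.map_eq_zero_of_pow_dvd (g : BaerSpecker →+ ℤ)
    (hg : ∀ n, g (Pi.single n 1) = 0) {p : ℕ} (hp : 1 < p) {x : BaerSpecker}
    (hx : ∀ n, (p : ℤ) ^ n ∣ x n) : g x = 0 := by
  have h : ∀ n, (p : ℤ) ^ n ∣ g x := by
    intro n
    rw [BaerSpecker.map_eq_sum_add_map_tail g x n]
    simp only [hg, mul_zero, Finset.sum_const_zero, zero_add]
    refine BaerSpecker.dvd_map g fun i => ?_
    split_ifs with hi
    · exact dvd_zero _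
    · exact (pow_dvd_pow _ (not_lt.1 hi)).trans (hx i)
  refine Int.eq_zero_of_abs_lt_dvd (h (g x).natAbs) ?_
  rw [Int.abs_eq_natAbs]
  exact_mod_cast Nat.lt_pow_self hp

/-- A homomorphism `ℤ^ℕ → ℤ` vanishing on the unit vectors is zero. -/
theorem BaerSpecker.eq_zero_of_single (g : BaerSpecker →+ ℤ)
    (hg : ∀ n, g (Pi.single n 1) = 0) : g = 0 := by
  ext x
  -- Bézout splits any vector into one with `n`-th entry divisible by `2 ^ n` and one with `3 ^ n`.
  have hc : ∀ n : ℕ, IsCoprime ((2 : ℤ) ^ n) ((3 : ℤ) ^ n) := fun n =>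
    IsCoprime.pow (by norm_num)
  choose a b hab using hc
  have hx : x = (fun n => a n * 2 ^ n * x n) + fun n => b n * 3 ^ n * x n := by
    ext n
    simp only [Pi.add_apply]
    rw [← add_mul, hab, one_mul]
  rw [hx, map_add, BaerSpecker.map_eq_zero_of_pow_dvd g hg (p := 2) (by norm_num),
    BaerSpecker.map_eq_zero_of_pow_dvd g hg (p := 3) (by norm_num)]
  · rfl
  · exact fun n => ⟨b n * x n, by push_cast; ring⟩
  · exact fun n => ⟨a n * x n, by push_cast; ring⟩

/-- Builds a test vector `d` for `c n = g (Pi.single n 1)`: `g d` is congruent to its partial sums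
modulo `d (n + 1)`, and growth turns the congruence into equality for large `n`. -/
theorem exists_dvd_chain_growing (c : ℕ → ℤ) : ∃ d : ℕ → ℤ, (∀ n, d n ≠ 0) ∧
    (∀ m n, m ≤ n → d m ∣ d n) ∧
    ∀ n : ℕ, (n + 1 : ℤ) + |∑ i ∈ Finset.range (n + 1), d i * c i| < d (n + 1) := by
  -- The pair is `d n` with the partial sum over `i < n`.
  let F : ℕ → ℤ × ℤ := fun n => Nat.rec (1, 0)
    (fun n p => (p.1 * (n + 2 + |p.2 + p.1 * c n|), p.2 + p.1 * c n)) n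
  have h1 : ∀ n, (F (n + 1)).1 = (F n).1 * (n + 2 + |(F (n + 1)).2|) := fun _ => rfl
  have h2 : ∀ n, (F (n + 1)).2 = (F n).2 + (F n).1 * c n := fun _ => rfl
  have hS : ∀ n, (F n).2 = ∑ i ∈ Finset.range n, (F i).1 * c i := by
    intro n
    induction n with
    | zero => rfl
    | succ n ih => rw [h2, Finset.sum_range_succ, ih]
  have hpos : ∀ n, 0 < (F n).1 := by
    intro n
    induction n with
    | zero => exact one_pos
    | succ n ih => rw [h1]; positivity
  refine ⟨fun n => (F n).1, fun n => (hpos n).ne', fun m n hmn => ?_, fun n => ?_⟩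
  · induction n, hmn using Nat.le_induction with
    | base => exact dvd_rfl
    | succ n _ ih => exact ih.trans (Dvd.intro _ (h1 n).symm)
  · change _ < (F (n + 1)).1
    rw [← hS, h1]
    have := hpos n
    have := abs_nonneg (F (n + 1)).2
    nlinarith

/-- A homomorphism `ℤ^ℕ → ℤ` vanishes on almost all unit vectors. -/
theorem BaerSpecker.exists_forall_ge_single_eq_zero (g : BaerSpecker →+ ℤ) :
    ∃ N, ∀ n, N ≤ n → g (Pi.single n 1) = 0 := by
  obtain ⟨d, hd0, hdvd, hgrow⟩ := exists_dvd_chain_growing fun n => g (Pi.single n 1)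
  have key : ∀ n, (g d).natAbs ≤ n →
      g d = ∑ i ∈ Finset.range (n + 1), d i * g (Pi.single i 1) := by
    intro n hn
    have hdiv : d (n + 1) ∣ g d - ∑ i ∈ Finset.range (n + 1), d i * g (Pi.single i 1) := by
      rw [BaerSpecker.map_eq_sum_add_map_tail g d (n + 1), add_sub_cancel_left]
      refine BaerSpecker.dvd_map g fun i => ?_
      split_ifs with hi
      · exact dvd_zero _
      · exact hdvd _ _ (not_lt.1 hi)
    refine sub_eq_zero.1 (Int.eq_zero_of_abs_lt_dvd hdiv ?_)
    have h1 := hgrow n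
    have h2 := abs_sub (g d) (∑ i ∈ Finset.range (n + 1), d i * g (Pi.single i 1))
    have h3 : |g d| ≤ n := by rw [Int.abs_eq_natAbs]; exact_mod_cast hn
    linarith
  refine ⟨(g d).natAbs + 1, fun n hn => ?_⟩
  obtain ⟨m, rfl⟩ : ∃ m, n = m + 1 := ⟨n - 1, by omega⟩
  have h1 := key m (by omega)
  have h2 := key (m + 1) (by omega)
  rw [Finset.sum_range_succ, ← h1] at h2
  have : d (m + 1) * g (Pi.single (m + 1) 1) = 0 := by linarith
  exact (mul_eq_zero.1 this).resolve_left (hd0 _)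

/-- Specker's theorem: every homomorphism `ℤ^ℕ → ℤ` depends on finitely many coordinates. -/
theorem BaerSpecker.exists_map_eq_sum (g : BaerSpecker →+ ℤ) :
    ∃ N, ∀ x, g x = ∑ i ∈ Finset.range N, x i * g (Pi.single i 1) := by
  obtain ⟨N, hN⟩ := BaerSpecker.exists_forall_ge_single_eq_zero g
  refine ⟨N, fun x => ?_⟩
  have h := BaerSpecker.eq_zero_of_single
    (g - ∑ i ∈ Finset.range N, g (Pi.single i 1) • Pi.evalAddMonoidHom (fun _ : ℕ => ℤ) i) (by
      intro n
      simp only [AddMonoidHom.sub_apply, AddMonoidHom.finsetSum_apply, AddMonoidHom.smul_apply,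
        Pi.evalAddMonoidHom_apply, Pi.single_apply, smul_eq_mul, mul_ite, mul_one, mul_zero]
      simp only [Finset.sum_ite_eq', Finset.mem_range]
      split_ifs with hn
      · simp
      · simp [hN n (not_lt.1 hn)])
  have hx := DFunLike.congr_fun h x
  simp only [AddMonoidHom.sub_apply, AddMonoidHom.finsetSum_apply, AddMonoidHom.smul_apply,
    Pi.evalAddMonoidHom_apply, smul_eq_mul, AddMonoidHom.zero_apply] at hx
  rw [sub_eq_zero.1 hx]
  exact Finset.sum_congr rfl fun _ _ => mul_comm _ _

theorem BaerSpecker.continuous_hom (g : BaerSpecker →+ ℤ) : Continuous g := by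
  obtain ⟨N, hN⟩ := BaerSpecker.exists_map_eq_sum g
  rw [funext hN]
  fun_prop

/-! ### Finiteness of pointwise bounded families. -/

/-- A pointwise bounded family of homomorphisms `ℤ^ℕ → ℤ` is finite. -/
theorem BaerSpecker.finite_of_pointwise_bounded (C : Set (BaerSpecker →+ ℤ))
    (hC : ∀ x, ∃ M : ℕ, ∀ g ∈ C, |g x| ≤ M) : C.Finite := by
  -- Baire category in `ℤ^ℕ`, covered by these closed sets.
  obtain ⟨M, x, hx⟩ : ∃ M : ℕ, (interior {x : BaerSpecker | ∀ g ∈ C, |g x| ≤ M}).Nonempty := by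
    refine nonempty_interior_of_iUnion_of_closed (fun M => ?_) ?_
    · simp only [Set.ofPred_forall]
      refine isClosed_iInter fun g => isClosed_iInter fun _ => ?_
      exact isClosed_le (BaerSpecker.continuous_hom g).abs continuous_const
    · exact Set.eq_univ_of_forall fun x => Set.mem_iUnion.2 (hC x)
  rw [mem_interior_iff_mem_nhds, nhds_pi, Filter.mem_pi] at hx
  obtain ⟨I, hI, t, ht, hsub⟩ := hx
  have hzero : ∀ n ∉ I, ∀ g ∈ C, g (Pi.single n 1) = 0 := by
    intro n hn g hg
    -- The neighbourhood leaves coordinate `n` free, and an affine function bounded on `ℤ` has slope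
    -- zero.
    have hmem : ∀ k : ℤ, |g x + k * g (Pi.single n 1)| ≤ M := by
      intro k
      have : x + k • Pi.single n 1 ∈ I.pi t := by
        intro i hi
        have : i ≠ n := fun h => hn (h ▸ hi)
        simpa [Pi.single_apply, this] using mem_of_mem_nhds (ht i)
      simpa only [map_add, map_zsmul, smul_eq_mul] using hsub this g hg
    by_contra hne
    have h1 := hmem (2 * M + 1)
    have h2 := hmem 0
    have h3 : (2 * M + 1 : ℤ) ≤ |(2 * M + 1) * g (Pi.single n 1)| := by
      rw [abs_mul, abs_of_nonneg (by positivity)]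
      exact le_mul_of_one_le_right (by positivity) (Int.one_le_abs hne)
    rw [zero_mul, add_zero] at h2
    have h4 := abs_sub (g x + (2 * M + 1) * g (Pi.single n 1)) (g x)
    rw [add_sub_cancel_left] at h4
    linarith
  choose B hB using fun i : ℕ => hC (Pi.single i 1)
  have hinj : Function.Injective fun (g : BaerSpecker →+ ℤ) (n : ℕ) => g (Pi.single n 1) := by
    intro g h hgh
    refine sub_eq_zero.1 (BaerSpecker.eq_zero_of_single _ fun n => ?_)
    simpa [sub_eq_zero] using congrFun hgh n
  classical
  have hfin : (Set.pi Set.univ fun n : ℕ =>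
      (if n ∈ I then Set.Icc (-(B n : ℤ)) (B n) else {0} : Set ℤ)).Finite := by
    refine Set.Finite.of_injOn (f := fun (v : ℕ → ℤ) (i : I) => v i)
      (t := Set.pi Set.univ fun i : I => Set.Icc (-(B i : ℤ)) (B i)) ?_ ?_ ?_
    · intro v hv i _
      simpa using hv i trivial
    · intro v hv w hw hvw
      ext n
      by_cases hn : n ∈ I
      · exact congrFun hvw ⟨n, hn⟩
      · have h1 := hv n trivial
        have h2 := hw n trivial
        simp only [hn, if_false, Set.mem_singleton_iff] at h1 h2
        rw [h1, h2]
    · have := hI.to_subtype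
      exact Set.Finite.pi fun i => Set.finite_Icc _ _
  refine Set.Finite.of_injOn (f := fun g n => g (Pi.single n 1)) (?_ : Set.MapsTo _ _ _)
    hinj.injOn hfin
  intro g hg n _
  simp only
  split_ifs with hn
  · exact abs_le.1 (hB n g hg)
  · exact hzero n hn g hg

/-! ### Continuous endomorphisms of the circle. -/

open MeasureTheory AddCircle in
/-- Every continuous endomorphism of the circle group is an integral power map. -/
theorem Circle.exists_zpow_of_continuous (φ : Circle →* Circle) (hφ : Continuous φ) :
    ∃ k : ℤ, ∀ z, φ z = z ^ k := by
  have : Fact (0 < (1 : ℝ)) := ⟨one_pos⟩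
  let f : C(AddCircle (1 : ℝ), ℂ) :=
    ⟨fun x => φ (toCircle x), continuous_subtype_val.comp (hφ.comp continuous_toCircle)⟩
  by_contra! hne
  have hcoeff : ∀ n : ℤ, fourierCoeff f n = 0 := by
    intro n
    obtain ⟨z, hz⟩ := hne n
    obtain ⟨a, rfl⟩ : ∃ a : AddCircle (1 : ℝ), toCircle a = z :=
      ⟨(homeomorphCircle one_ne_zero).symm z, by
        rw [← homeomorphCircle_apply one_ne_zero, Homeomorph.apply_symm_apply]⟩
    set u : ℂ := (fourier (-n) a : ℂ) * f a with hu
    have hu1 : u ≠ 1 := by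
      intro h
      apply hz
      have h' : ((toCircle a ^ (-n) * φ (toCircle a) : Circle) : ℂ) = 1 := by
        rw [← h, hu, fourier_apply, toCircle_zsmul]
        simp [f]
      have h'' : toCircle a ^ (-n) * φ (toCircle a) = 1 := Circle.ext (by simpa using h')
      rw [zpow_neg, inv_mul_eq_one] at h''
      exact h''.symm
    have hshift : ∀ t, fourier (-n) (t + a) • f (t + a) = u * (fourier (-n) t • f t) := by
      intro t
      simp only [hu, fourier_apply, smul_add, toCircle_add, Circle.coe_mul, smul_eq_mul, f,
        ContinuousMap.coe_mk, map_mul]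
      ring
    -- Invariance of Haar measure under translation by `a`; as `u ≠ 1`, the coefficient vanishes.
    -- Parseval then contradicts `|f| = 1`.
    have hint : fourierCoeff f n = u * fourierCoeff f n := by
      unfold fourierCoeff
      conv_lhs => rw [← integral_add_right_eq_self _ a]
      simp_rw [hshift]
      exact integral_const_mul _ _
    have : (1 - u) * fourierCoeff f n = 0 := by linear_combination hint
    exact (mul_eq_zero.1 this).resolve_left (sub_ne_zero.2 hu1.symm)
  have hP := tsum_sq_fourierCoeff (ContinuousMap.toLp (E := ℂ) 2 haarAddCircle ℂ f)
  have h1 : ∫ t, ‖(ContinuousMap.toLp (E := ℂ) 2 haarAddCircle ℂ f) t‖ ^ 2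
      ∂(haarAddCircle (T := (1 : ℝ))) = 1 := by
    rw [integral_congr_ae (g := fun _ => (1 : ℝ))]
    · simp
    · filter_upwards [ContinuousMap.coeFn_toLp (p := 2) (𝕜 := ℂ) haarAddCircle f] with t ht
      rw [ht]
      change ‖(φ (toCircle t) : ℂ)‖ ^ 2 = 1
      rw [Circle.norm_coe, one_pow]
  rw [h1] at hP
  simp only [fourierCoeff_toLp, hcoeff] at hP
  simp at hP

/-! ### The dual of `G` and its topology. -/

namespace BaerSpeckerHom

open Multiplicative

instance : AddMonoidHomClass BaerSpeckerHom BaerSpecker ℤ :=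
  inferInstanceAs (AddMonoidHomClass (BaerSpecker →+ ℤ) BaerSpecker ℤ)

/-- The `n`-th coordinate projection of `ℤ^ℕ`. -/
def coord (n : ℕ) : BaerSpeckerHom := Pi.evalAddMonoidHom (fun _ : ℕ => ℤ) n

theorem coord_apply (n : ℕ) (x : BaerSpecker) : coord n x = x n := rfl

/-- Evaluation at `x ∈ ℤ^ℕ`, as a homomorphism `Hom(ℤ^ℕ, ℤ) → ℤ`. -/
def evalHom (x : BaerSpecker) : BaerSpeckerHom →+ ℤ :=
  (AddMonoidHom.eval x : (BaerSpecker →+ ℤ) →+ ℤ)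

theorem evalHom_apply (x : BaerSpecker) (g : BaerSpeckerHom) : evalHom x g = g x := rfl

theorem ext_apply {g h : BaerSpeckerHom} (H : ∀ x, g x = h x) : g = h := DFunLike.ext _ _ H

theorem continuous_evalHom (x : BaerSpecker) : Continuous (evalHom x) :=
  (continuous_apply x).comp continuous_induced_dom

theorem exists_eq_sum_coord (g : BaerSpeckerHom) :
    ∃ N, g = ∑ i ∈ Finset.range N, g (Pi.single i 1) • coord i := by
  obtain ⟨N, hN⟩ := BaerSpecker.exists_map_eq_sum g
  refine ⟨N, ext_apply fun x => ?_⟩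
  rw [← evalHom_apply x (∑ i ∈ Finset.range N, _), map_sum]
  simp only [map_zsmul, evalHom_apply, coord_apply, smul_eq_mul]
  refine (hN x).trans (Finset.sum_congr rfl fun _ _ => mul_comm _ _)

/-- A homomorphism out of `Hom(ℤ^ℕ, ℤ)` is determined by its values on the coordinates. -/
theorem map_eq_prod_coord {H F : Type*} [CommGroup H] [FunLike F (Multiplicative BaerSpeckerHom) H]
    [MonoidHomClass F (Multiplicative BaerSpeckerHom) H] (g : BaerSpeckerHom) :
    ∃ N, ∀ χ : F, χ (ofAdd g) =
      ∏ i ∈ Finset.range N, χ (ofAdd (coord i)) ^ g (Pi.single i 1) := by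
  obtain ⟨N, hN⟩ := exists_eq_sum_coord g
  refine ⟨N, fun χ => ?_⟩
  conv_lhs => rw [hN]
  rw [ofAdd_sum, map_prod]
  exact Finset.prod_congr rfl fun i _ => by rw [ofAdd_zsmul, map_zpow]

/-- Compact subsets of `Hom(ℤ^ℕ, ℤ)` are finite. -/
theorem finite_of_isCompact {K : Set (Multiplicative BaerSpeckerHom)} (hK : IsCompact K) :
    K.Finite := by
  refine BaerSpecker.finite_of_pointwise_bounded (toAdd '' K) (fun x => ?_) |>.of_finite_image
    toAdd.injective.injOn
  obtain ⟨M, hM⟩ := ((hK.image (continuous_evalHom x)).isBounded).exists_norm_le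
  refine ⟨⌈M⌉₊, ?_⟩
  rintro _ ⟨g, hg, rfl⟩
  have h := (hM _ ⟨g, hg, rfl⟩).trans (Nat.le_ceil M)
  rw [Int.norm_eq_abs] at h
  exact_mod_cast h

/-- The values of a character of `Hom(ℤ^ℕ, ℤ)` on the coordinates. -/
noncomputable def dualCoord (χ : PontryaginDual (Multiplicative BaerSpeckerHom)) (n : ℕ) :
    Circle :=
  χ (ofAdd (coord n))

instance : ContinuousEvalConst (PontryaginDual (Multiplicative BaerSpeckerHom))
    (Multiplicative BaerSpeckerHom) Circle :=
  inferInstanceAs (ContinuousEvalConst (Multiplicative BaerSpeckerHom →ₜ* Circle) _ _)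

/-- Evaluation at an element is a continuous function of the coordinates of a character. -/
theorem exists_continuous_dualCoord (g : Multiplicative BaerSpeckerHom) :
    ∃ v : (ℕ → Circle) → Circle, Continuous v ∧
      ∀ χ : PontryaginDual (Multiplicative BaerSpeckerHom), χ g = v (dualCoord χ) := by
  obtain ⟨N, hN⟩ := map_eq_prod_coord (H := Circle)
    (F := PontryaginDual (Multiplicative BaerSpeckerHom)) (toAdd g)
  exact ⟨fun s => ∏ i ∈ Finset.range N, s i ^ toAdd g (Pi.single i 1),
    continuous_finsetProd _ fun i _ => (continuous_apply i).zpow _, hN⟩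

/-- The dual of `Hom(ℤ^ℕ, ℤ)` carries the topology induced from `𝕋^ℕ`. -/
theorem isInducing_dualCoord : Topology.IsInducing dualCoord := by
  refine ⟨le_antisymm ?_ ?_⟩
  · rw [← continuous_iff_le_induced]
    exact continuous_pi fun n => continuous_eval_const _
  · refine continuous_iff_le_induced.1 (continuous_generateFrom_iff.2 ?_)
    rintro _ ⟨K, hK, U, hU, rfl⟩
    choose v hv hχ using exists_continuous_dualCoord
    refine isOpen_induced_iff.2 ⟨⋂ g ∈ K, v g ⁻¹' U,
      (finite_of_isCompact hK).isOpen_biInter fun g _ => hU.preimage (hv g), ?_⟩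
    ext χ
    simp only [Set.mem_preimage, Set.mem_iInter, ← hχ]
    rfl

/-- The character `g ↦ t ^ g x` of `Hom(ℤ^ℕ, ℤ)`. -/
noncomputable def powChar (x : BaerSpecker) (t : Circle) :
    PontryaginDual (Multiplicative BaerSpeckerHom) where
  toFun g := t ^ toAdd g x
  map_one' := by
    change t ^ evalHom x 0 = 1
    rw [map_zero, zpow_zero]
  map_mul' g h := by
    change t ^ evalHom x (toAdd g + toAdd h) = _
    rw [map_add, zpow_add]
    rfl
  continuous_toFun :=
    (continuous_of_discreteTopology (f := fun k : ℤ => t ^ k)).comp (continuous_evalHom x)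

theorem dualCoord_powChar (x : BaerSpecker) (t : Circle) (n : ℕ) :
    dualCoord (powChar x t) n = t ^ x n := rfl

theorem dualCoord_powChar_single (i n : ℕ) (t : Circle) :
    dualCoord (powChar (Pi.single i 1) t) n = if n = i then t else 1 := by
  rw [dualCoord_powChar, Pi.single_apply]
  split_ifs <;> simp

/-- `powChar` as a homomorphism in the circle variable. -/
noncomputable def powCharHom (x : BaerSpecker) :
    Circle →* PontryaginDual (Multiplicative BaerSpeckerHom) where
  toFun := powChar x
  map_one' := PontryaginDual.ext fun _ => one_zpow _
  map_mul' _ _ := PontryaginDual.ext fun _ => mul_zpow _ _ _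

theorem continuous_powCharHom (x : BaerSpecker) : Continuous (powCharHom x) :=
  isInducing_dualCoord.continuous_iff.2 <|
    continuous_pi fun n => continuous_id.zpow (x n)

/-! ### The second dual: bijectivity of evaluation and discreteness. -/

/-- Evaluation `g ↦ (χ ↦ χ g)` into the second dual of `Hom(ℤ^ℕ, ℤ)`. -/
noncomputable def bidualEval : Multiplicative BaerSpeckerHom →*
    PontryaginDual (PontryaginDual (Multiplicative BaerSpeckerHom)) where
  toFun g :=
    { toFun := fun χ => χ g
      map_one' := rfl
      map_mul' := fun _ _ => rfl
      continuous_toFun := continuous_eval_const g }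
  map_one' := PontryaginDual.ext fun χ => map_one χ
  map_mul' g h := PontryaginDual.ext fun χ => map_mul χ g h

theorem bidualEval_apply (g : Multiplicative BaerSpeckerHom)
    (χ : PontryaginDual (Multiplicative BaerSpeckerHom)) : bidualEval g χ = χ g := rfl

/-- A character of the dual of `Hom(ℤ^ℕ, ℤ)` depends on finitely many coordinates only. -/
theorem exists_forall_dualCoord_eq_one
    (ψ : PontryaginDual (PontryaginDual (Multiplicative BaerSpeckerHom))) :
    ∃ I : Finset ℕ, ∀ χ, (∀ i ∈ I, dualCoord χ i = 1) → ψ χ = 1 := by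
  have hV : ψ ⁻¹' Circle.centeredArc (Real.pi / 2) ∈
      nhds (1 : PontryaginDual (Multiplicative BaerSpeckerHom)) := by
    refine (map_continuous ψ).continuousAt.preimage_mem_nhds ?_
    rw [map_one]
    refine (Circle.isOpen_centeredArc _).mem_nhds ?_
    rw [Circle.mem_centeredArc (by linarith [Real.pi_pos])]
    simp [Real.pi_pos]
  rw [isInducing_dualCoord.nhds_eq_comap, nhds_pi, Filter.mem_comap] at hV
  obtain ⟨W, hW, hsub⟩ := hV
  obtain ⟨I, hI, t, ht, hIt⟩ := Filter.mem_pi.1 hW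
  refine ⟨hI.toFinset, fun χ hχ => Circle.eq_one_of_forall_pow_mem_centeredArc_pi_div_two
    fun n _ => ?_⟩
  rw [← map_pow]
  refine hsub (hIt fun i hi => ?_)
  -- All powers of `χ` stay in the neighbourhood, so all powers of `ψ χ` stay in the arc, forcing `ψ
  -- χ = 1`.
  have h1 : dualCoord (χ ^ n) i = 1 := by
    rw [show dualCoord (χ ^ n) i = dualCoord χ i ^ n from
      map_pow (bidualEval (ofAdd (coord i))) χ n, hχ i (hI.mem_toFinset.2 hi), one_pow]
  rw [h1]
  exact mem_of_mem_nhds (ht i)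

theorem bidualEval_surjective : Function.Surjective bidualEval := by
  intro ψ
  obtain ⟨I, hI⟩ := exists_forall_dualCoord_eq_one ψ
  have hpow : ∀ i : ℕ, ∃ k : ℤ, ∀ t, ψ (powChar (Pi.single i 1) t) = t ^ k := fun i =>
    Circle.exists_zpow_of_continuous ((ψ : _ →* Circle).comp (powCharHom (Pi.single i 1)))
      ((map_continuous ψ).comp (continuous_powCharHom _))
  choose k hk using hpow
  refine ⟨∏ i ∈ I, ofAdd (coord i) ^ k i, PontryaginDual.ext fun χ => ?_⟩
  -- The truncation of `χ` to the coordinates in `I`, which `ψ` cannot tell from `χ`.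
  set χ' := ∏ i ∈ I, powChar (Pi.single i 1) (dualCoord χ i) with hχ'
  have hcoord : ∀ n ∈ I, dualCoord χ' n = dualCoord χ n := by
    intro n hn
    have : dualCoord χ' n = ∏ i ∈ I, dualCoord (powChar (Pi.single i 1) (dualCoord χ i)) n :=
      map_prod (bidualEval (ofAdd (coord n))) _ _
    simp only [this, dualCoord_powChar_single, Finset.prod_ite_eq, hn, if_true]
  have h1 : ψ (χ * χ'⁻¹) = 1 := hI _ fun n hn => by
    change dualCoord χ n * (dualCoord χ' n)⁻¹ = 1
    rw [hcoord n hn, mul_inv_cancel]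
  rw [map_mul, map_inv, mul_inv_eq_one] at h1
  rw [h1, hχ', bidualEval_apply, map_prod, map_prod]
  exact Finset.prod_congr rfl fun i _ => by rw [hk, map_zpow]; rfl

/-- A circle element whose powers distinguish nonzero exponents from zero. -/
theorem exists_circle_zpow_ne_one {k : ℤ} (hk : k ≠ 0) : ∃ t : Circle, t ^ k ≠ 1 := by
  refine ⟨Circle.exp (Real.pi / k), ?_⟩
  rw [← Circle.exp_intCast_mul, mul_div_cancel₀ _ (Int.cast_ne_zero.2 hk)]
  exact Circle.exp_pi_ne_one

theorem bidualEval_injective : Function.Injective bidualEval := by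
  refine (injective_iff_map_eq_one _).2 fun g hg => ?_
  by_contra hne
  obtain ⟨x, hx⟩ : ∃ x, toAdd g x ≠ 0 := by
    by_contra! h
    exact hne (ext_apply (g := toAdd g) (h := 0) h)
  obtain ⟨t, ht⟩ := exists_circle_zpow_ne_one hx
  exact ht (DFunLike.congr_fun hg (powChar x t))

/-- The characters nontrivial on at most one coordinate form a compact set. -/
theorem isCompact_setOf_dualCoord :
    IsCompact {χ | ∀ m n, m ≠ n → dualCoord χ m = 1 ∨ dualCoord χ n = 1} := by
  have hcl : IsClosed {s : ℕ → Circle | ∀ m n, m ≠ n → s m = 1 ∨ s n = 1} := by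
    simp only [Set.ofPred_forall]
    refine isClosed_iInter fun m => isClosed_iInter fun n => isClosed_iInter fun _ => ?_
    exact (isClosed_eq (continuous_apply m) continuous_const).union
      (isClosed_eq (continuous_apply n) continuous_const)
  -- Compactness pulls back only if the closed set lies in the range of `dualCoord`; its points are
  -- attained by `powChar` at a unit vector.
  refine isInducing_dualCoord.isCompact_preimage' hcl.isCompact fun s hs => ?_
  by_cases h : ∃ i, s i ≠ 1
  · obtain ⟨i, hi⟩ := h
    refine ⟨powChar (Pi.single i 1) (s i), funext fun n => ?_⟩
    rw [dualCoord_powChar_single]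
    split_ifs with hn
    · rw [hn]
    · exact ((hs n i hn).resolve_right hi).symm
  · push Not at h
    exact ⟨1, funext fun n => (h n).symm⟩

theorem discreteTopology_bidual :
    DiscreteTopology (PontryaginDual (PontryaginDual (Multiplicative BaerSpeckerHom))) := by
  refine discreteTopology_of_isOpen_singleton_one ?_
  have hopen : IsOpen {ψ : PontryaginDual (PontryaginDual (Multiplicative BaerSpeckerHom)) |
      Set.MapsTo ψ {χ | ∀ m n, m ≠ n → dualCoord χ m = 1 ∨ dualCoord χ n = 1}
        (Circle.centeredArc (Real.pi / 2))} :=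
    isOpen_induced (ContinuousMap.isOpen_setOfPred_mapsTo isCompact_setOf_dualCoord
      (Circle.isOpen_centeredArc _))
  convert hopen
  ext ψ
  rw [Set.mem_singleton_iff]
  refine ⟨?_, fun hψ => ?_⟩
  · rintro rfl χ _
    rw [Circle.mem_centeredArc (by linarith [Real.pi_pos])]
    simp [Real.pi_pos]
  -- The compact set contains each of these circle subgroups, so the image of each is a subgroup
  -- inside the arc.
  · have h1 : ∀ i t, ψ (powChar (Pi.single i 1) t) = 1 := fun i t =>
      Circle.eq_one_of_forall_pow_mem_centeredArc_pi_div_two fun n _ => by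
        rw [← map_pow]
        have : powChar (Pi.single i 1) t ^ n = powChar (Pi.single i 1) (t ^ n) :=
          (map_pow (powCharHom _) t n).symm
        rw [this]
        refine hψ fun m m' hmm => ?_
        simp only [dualCoord_powChar_single]
        by_cases h : m = i
        · exact Or.inr (if_neg fun h' => hmm (h.trans h'.symm))
        · exact Or.inl (if_neg h)
    obtain ⟨g, rfl⟩ := bidualEval_surjective ψ
    have h2 : ∀ i, toAdd g (Pi.single i 1) = 0 := by
      intro i
      by_contra hne
      obtain ⟨t, ht⟩ := exists_circle_zpow_ne_one hne
      exact ht (h1 i t)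
    have h3 : g = 1 := BaerSpecker.eq_zero_of_single (toAdd g) h2
    rw [h3, map_one]

end BaerSpeckerHom

/-- The second Pontryagin dual of `G = Hom(ℤ^ℕ, ℤ)` (written multiplicatively, as Mathlib's
`PontryaginDual` requires) is discrete, and evaluation `g ↦ (χ ↦ χ g)` is an isomorphism of
abstract groups from `G` onto it. -/
theorem corollary3p2 :
    DiscreteTopology (PontryaginDual (PontryaginDual (Multiplicative BaerSpeckerHom))) ∧
    ∃ α : Multiplicative BaerSpeckerHom ≃*
        PontryaginDual (PontryaginDual (Multiplicative BaerSpeckerHom)),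
      ∀ (g : Multiplicative BaerSpeckerHom) (χ : PontryaginDual (Multiplicative BaerSpeckerHom)),
        α g χ = χ g :=
  ⟨BaerSpeckerHom.discreteTopology_bidual,
    MulEquiv.ofBijective BaerSpeckerHom.bidualEval
      ⟨BaerSpeckerHom.bidualEval_injective, BaerSpeckerHom.bidualEval_surjective⟩,
    fun _ _ => rfl⟩
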